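/- Let $\mathbb{K}$ be a field, let $G$ be a finite simple graph with vertex set $\{v_1,\dots,v_n\}$, let $S=\mathbb{K}[x_1,\dots,x_n]$, and let $I(G)=(x_ix_j : \{v_i,v_j\}\in E(G))\subseteq S$ be the edge ideal of $G$. For a monomial ideal $I\subseteq S$, a Stanley decomposition of $I$ is a decomposition $\mathcal D: I=\bigoplus_{t=1}^{r}u_t\mathbb{K}[Z_t]$ as a finite direct sum of $\mathbb{K}$-vector spaces, where each $u_t\in I$ is a nonzero scalar multiple of a monomial, $Z_t\subseteq\{x_1,\dots,x_n\}$, and $u_t\mathbb{K}[Z_t]$ is the $\mathbb{K}$-span of all $u_tv$ with $v$ a monomial in $\mathbb{K}[Z_t]$; put $\mathrm{sdepth}(\mathcal D)=\min_t|Z_t|$. The Stanley depth $\mathrm{sdepth}(I)$ is the maximum of $\mathrm{sdepth}(\mathcal D)$ over all Stanley decompositions $\mathcal D$ of $I$ (with $\mathrm{sdepth}(0)=\infty$). The girth of a graph is the length of a shortest cycle, and $\infty$ if there is no cycle. Suppose that $G$ is bipartite and has at least one edge. Let $p$ be the number of connected components of $G$ (isolated vertices included), and let $g$ be the maximum of the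 girths of those connected components of $G$ that have at least one edge. Then $\mathrm{sdepth}(I(G)^k)\geq p+1$ for every positive integer $k\leq g/2+1$ (for every positive integer $k$ if $g=\infty$). -/

import Mathlib

/-- The edge ideal `I(G) = (x_i x_j : {i, j} ∈ E(G))` of a simple graph `G` on the vertex set `V`,
in the polynomial ring over `K` with one variable for each vertex. -/
noncomputable def edgeIdeal (K : Type*) [Field K] {V : Type*} (G : SimpleGraph V) :
    Ideal (MvPolynomial V K) :=
  Ideal.span {f | ∃ i j : V, G.Adj i j ∧ f = MvPolynomial.X i * MvPolynomial.X j}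

/-- The `K`-subspace `u K[Z]` of the polynomial ring: the span of all products `u * v`, where `v` is
a monomial in the variables from `Z`. -/
noncomputable def stanleySpace {K : Type*} [Field K] {V : Type*} (u : MvPolynomial V K) (Z : Finset V) :
    Submodule K (MvPolynomial V K) :=
  Submodule.span K {f | ∃ b : V →₀ ℕ, b.support ⊆ Z ∧ f = u * MvPolynomial.monomial b 1}

/-- A Stanley decomposition of a (monomial) ideal `I`: a presentation of `I` as a finite internal
direct sum of Stanley spaces `u K[Z]`, where `u ∈ I` is homogeneous for the fine (multi-)grading,
i.e. a scalar multiple of a monomial. As the polynomial ring is a domain, `u K[Z]` is a free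
`K[Z]`-module on the generator `u` exactly when `u ≠ 0`. -/
structure StanleyDecomposition {K : Type*} [Field K] {V : Type*}
    (I : Ideal (MvPolynomial V K)) where
  /-- the number of Stanley spaces -/
  size : ℕ
  /-- the generators of the Stanley spaces -/
  gen : Fin size → MvPolynomial V K
  /-- the sets of variables of the Stanley spaces -/
  vars : Fin size → Finset V
  gen_mem : ∀ t, gen t ∈ I
  gen_homogeneous : ∀ t, ∃ (a : V →₀ ℕ) (c : K), gen t = MvPolynomial.monomial a c
  gen_ne_zero : ∀ t, gen t ≠ 0
  independent : iSupIndep fun t => stanleySpace (gen t) (vars t)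
  iSup_eq : ⨆ t, stanleySpace (gen t) (vars t) = I.restrictScalars K

/-- The Stanley depth of a Stanley decomposition: the least dimension `|Z|` of its Stanley spaces
(`⊤` for the empty decomposition, which occurs only for the zero ideal). -/
noncomputable def StanleyDecomposition.sdepth {K : Type*} [Field K] {V : Type*}
    {I : Ideal (MvPolynomial V K)} (D : StanleyDecomposition I) : ℕ∞ :=
  ⨅ t, ((D.vars t).card : ℕ∞)

/-- The Stanley depth of a monomial ideal: the maximum of the Stanley depths of its Stanley
decompositions. It is `⊤` for the zero ideal; for a nonzero monomial ideal in finitely many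
variables the supremum is over a nonempty set bounded by the number of variables, so it is a
maximum. -/
noncomputable def stanleyDepth {K : Type*} [Field K] {V : Type*}
    (I : Ideal (MvPolynomial V K)) : ℕ∞ :=
  ⨆ D : StanleyDecomposition I, D.sdepth

/-- The maximum of the girths (`⊤` for an acyclic component) of those connected components of `G`
that have at least one edge, i.e. that are not isolated vertices. -/
noncomputable def maxComponentGirth {V : Type*} (G : SimpleGraph V) : ℕ∞ :=
  ⨆ C : {C : G.ConnectedComponent // C.toSimpleGraph.edgeSet.Nonempty}, C.1.toSimpleGraph.egirth

/-! A monomial ideal is spanned by its monomials, and a finite partition of its exponent set into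
cones `a + ℕ^Z` with `d ≤ |Z|` gives a Stanley decomposition, so the claim is combinatorial.

Write `I` for the edge ideal. By weighted König duality (`mem_edgePowerExponents_of_cover`), a
monomial outside `I^k` has a vertex cover of weight less than `k`, and multiplying by a variable off
the cover does not change that weight. So on any nonempty vertex set some direction stays outside
`I^k` forever (`exists_ray_notMem_edgePowerExponents`). Hence each level `I^j \ I^(j+1)` splits into
cones of dimension at least 1, and on at least two variables each power splits into cones of
dimension at least 2 (`IsUpperSet.hasConePartition_two`).

The order of a monomial, the largest `j` with the monomial in `I^j`, is additive over unions of
components. Sorting by the order on `W'` writes `I^k` on `W ∪ W'` as a disjoint union of products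
(`hasConePartition_union_of_levels`), and dimensions add. One component with an edge contributes 2
and each of the other `p - 1` contributes 1. -/

open scoped Pointwise

/-! ### Cones of exponent vectors and their disjoint unions and sums. -/

section ConePartitions

variable {V : Type*}

/-- The exponent vectors of the monomials in `x^a K[Z]`. -/
def exponentCone (a : V → ℕ) (Z : Finset V) : Set (V → ℕ) :=
  {u | a ≤ u ∧ ∀ v, v ∉ Z → u v = a v}

/-- The exponent vectors supported on `W`. -/
def exponentsOn (W : Set V) : Set (V → ℕ) := {u | ∀ v, v ∉ W → u v = 0}

/-- `A` is a finite disjoint union of cones of dimension at least `d`. -/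
inductive HasConePartition (d : ℕ) : Set (V → ℕ) → Prop
  | empty : HasConePartition d ∅
  | insert (a : V → ℕ) (Z : Finset V) (A : Set (V → ℕ)) : d ≤ Z.card → HasConePartition d A →
      Disjoint (exponentCone a Z) A → HasConePartition d (exponentCone a Z ∪ A)

lemma hasConePartition_cone {d : ℕ} (a : V → ℕ) (Z : Finset V) (h : d ≤ Z.card) :
    HasConePartition d (exponentCone a Z) := by
  simpa using HasConePartition.insert a Z ∅ h .empty (Set.disjoint_empty _)

lemma HasConePartition.union {d : ℕ} {A B : Set (V → ℕ)} (hA : HasConePartition d A)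
    (hB : HasConePartition d B) (h : Disjoint A B) : HasConePartition d (A ∪ B) := by
  induction hA with
  | empty => simpa using hB
  | insert a Z A hd _ hdis ih =>
    rw [Set.disjoint_union_left] at h
    rw [Set.union_assoc]
    exact .insert a Z _ hd (ih h.2) (Set.disjoint_union_right.2 ⟨hdis, h.1⟩)

lemma HasConePartition.biUnion {d : ℕ} {ι : Type*} (s : Finset ι) (A : ι → Set (V → ℕ))
    (hA : ∀ i ∈ s, HasConePartition d (A i)) (h : (s : Set ι).PairwiseDisjoint A) :
    HasConePartition d (⋃ i ∈ s, A i) := by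
  classical
  induction s using Finset.induction_on with
  | empty => simpa using HasConePartition.empty
  | insert i s his ih =>
    rw [Finset.set_biUnion_insert]
    refine (hA i (by simp)).union (ih (fun j hj => hA j (by simp [hj]))
      (h.subset (by simp))) ?_
    rw [Set.disjoint_iUnion₂_right]
    intro j hj
    exact h (by simp) (by simp [hj]) (by rintro rfl; exact his hj)

lemma HasConePartition.exists_family {d : ℕ} {A : Set (V → ℕ)} (h : HasConePartition d A) :
    ∃ (n : ℕ) (a : Fin n → V → ℕ) (Z : Fin n → Finset V), (∀ t, d ≤ (Z t).card) ∧
      Pairwise (fun s t => Disjoint (exponentCone (a s) (Z s)) (exponentCone (a t) (Z t))) ∧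
      ⋃ t, exponentCone (a t) (Z t) = A := by
  induction h with
  | empty => exact ⟨0, Fin.elim0, Fin.elim0, fun t => t.elim0, fun t => t.elim0, by simp⟩
  | insert b Y A hd _ hdis ih =>
    obtain ⟨n, a, Z, h1, h2, h3⟩ := ih
    have hsub : ∀ t, exponentCone (a t) (Z t) ⊆ A := fun t => by
      rw [← h3]
      exact Set.subset_iUnion (fun t => exponentCone (a t) (Z t)) t
    refine ⟨n + 1, Fin.cons b a, Fin.cons Y Z, ?_, ?_, ?_⟩
    · intro t
      induction t using Fin.cases <;> simp [hd, h1]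
    · intro s t hst
      induction s using Fin.cases with
      | zero =>
        induction t using Fin.cases with
        | zero => exact absurd rfl hst
        | succ t => exact hdis.mono_right (hsub t)
      | succ s =>
        induction t using Fin.cases with
        | zero => exact (hdis.mono_right (hsub s)).symm
        | succ t => exact h2 (ne_of_apply_ne Fin.succ hst)
    · ext u
      simp only [Set.mem_iUnion, Fin.exists_fin_succ, Fin.cons_zero, Fin.cons_succ, ← h3,
        Set.mem_union]

lemma add_eq_add_of_mem_exponentsOn {W W' : Set V} (hW : Disjoint W W') {a b a' b' : V → ℕ}
    (ha : a ∈ exponentsOn W) (hb : b ∈ exponentsOn W) (ha' : a' ∈ exponentsOn W')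
    (hb' : b' ∈ exponentsOn W') (h : a + a' = b + b') : a = b ∧ a' = b' := by
  have key : ∀ v, a v = b v ∧ a' v = b' v := by
    intro v
    have h1 := congrFun h v
    simp only [Pi.add_apply] at h1
    by_cases hv : v ∈ W
    · have hv' := Set.disjoint_left.1 hW hv
      rw [ha' v hv', hb' v hv'] at *
      omega
    · rw [ha v hv, hb v hv] at *
      omega
  exact ⟨funext fun v => (key v).1, funext fun v => (key v).2⟩

lemma disjoint_add_of_left {W W' : Set V} (hW : Disjoint W W') {A B A' B' : Set (V → ℕ)}
    (hA : A ⊆ exponentsOn W) (hB : B ⊆ exponentsOn W) (hA' : A' ⊆ exponentsOn W')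
    (hB' : B' ⊆ exponentsOn W') (h : Disjoint A B) : Disjoint (A + A') (B + B') := by
  rw [Set.disjoint_left]
  rintro _ ⟨a, ha, a', ha', rfl⟩ ⟨b, hb, b', hb', he⟩
  have := (add_eq_add_of_mem_exponentsOn hW (hA ha) (hB hb) (hA' ha') (hB' hb') he.symm).1
  exact Set.disjoint_left.1 h ha (this ▸ hb)

lemma disjoint_add_of_right {W W' : Set V} (hW : Disjoint W W') {A B A' B' : Set (V → ℕ)}
    (hA : A ⊆ exponentsOn W) (hB : B ⊆ exponentsOn W) (hA' : A' ⊆ exponentsOn W')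
    (hB' : B' ⊆ exponentsOn W') (h : Disjoint A' B') : Disjoint (A + A') (B + B') := by
  rw [add_comm A, add_comm B]
  exact disjoint_add_of_left hW.symm hA' hB' hA hB h

lemma self_mem_exponentCone (a : V → ℕ) (Z : Finset V) : a ∈ exponentCone a Z :=
  ⟨le_rfl, fun _ _ => rfl⟩

lemma subset_of_exponentCone_subset [DecidableEq V] {a : V → ℕ} {Z : Finset V} {W : Set V}
    (h : exponentCone a Z ⊆ exponentsOn W) : (Z : Set V) ⊆ W := by
  intro v hv
  by_contra hvW
  have hmem : a + Pi.single v 1 ∈ exponentCone a Z := by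
    refine ⟨le_self_add, fun w hw => ?_⟩
    have : w ≠ v := by rintro rfl; exact hw hv
    simp [this]
  have := h hmem v hvW
  simp at this

lemma exponentCone_add_exponentCone [DecidableEq V] (a b : V → ℕ) (Y Z : Finset V) :
    exponentCone a Y + exponentCone b Z = exponentCone (a + b) (Y ∪ Z) := by
  ext u
  constructor
  · rintro ⟨x, ⟨hx, hx'⟩, y, ⟨hy, hy'⟩, rfl⟩
    refine ⟨add_le_add hx hy, fun v hv => ?_⟩
    simp only [Finset.mem_union, not_or] at hv
    simp [hx' v hv.1, hy' v hv.2]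
  · rintro ⟨hu, hu'⟩
    have hle : ∀ v, a v + b v ≤ u v := hu
    -- The excess over `a + b` goes to the first summand on `Y` and to the second elsewhere.
    refine ⟨fun v => if v ∈ Y then u v - b v else a v, ⟨fun v => ?_, fun v hv => by simp [hv]⟩,
      fun v => if v ∈ Y then b v else u v - a v, ⟨fun v => ?_, fun v hv => ?_⟩, ?_⟩
    · have := hle v
      simp only
      split_ifs <;> omega
    · have := hle v
      simp only
      split_ifs <;> omega
    · by_cases hv' : v ∈ Y
      · simp [hv']
      · have := hu' v (by simp [hv, hv'])
        simp only [Pi.add_apply] at this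
        simp only [hv', if_false]
        omega
    · funext v
      have := hle v
      simp only [Pi.add_apply]
      split_ifs <;> omega

/-- On disjoint sets of variables the sum is a direct product, so products of cones tile it, and
their sets of free directions are disjoint. -/
lemma HasConePartition.add {d e : ℕ} {W W' : Set V} (hW : Disjoint W W') {A B : Set (V → ℕ)}
    (hA : HasConePartition d A) (hB : HasConePartition e B) (hAW : A ⊆ exponentsOn W)
    (hBW : B ⊆ exponentsOn W') : HasConePartition (d + e) (A + B) := by
  classical
  induction hA with
  | empty => simpa using HasConePartition.empty
  | insert a Y A hd _ hdis ih =>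
    rw [Set.union_subset_iff] at hAW
    rw [Set.union_add]
    refine HasConePartition.union ?_ (ih hAW.2)
      (disjoint_add_of_left hW hAW.1 hAW.2 hBW hBW hdis)
    clear ih
    induction hB with
    | empty => simpa using HasConePartition.empty
    | insert b Z B he _ hdis' ih =>
      rw [Set.union_subset_iff] at hBW
      rw [Set.add_union]
      refine HasConePartition.union ?_ (ih hBW.2)
        (disjoint_add_of_right hW hAW.1 hAW.1 hBW.1 hBW.2 hdis')
      have hYZ : Disjoint Y Z := Finset.disjoint_coe.1
        (hW.mono (subset_of_exponentCone_subset hAW.1) (subset_of_exponentCone_subset hBW.1))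
      rw [exponentCone_add_exponentCone]
      exact hasConePartition_cone _ _ (by rw [Finset.card_union_of_disjoint hYZ]; omega)

/-! ### Truncation, ray slices, and cones of dimension one and two. -/

/-- Membership in `A` only depends on the exponents cut off at `N`. -/
def IsTruncated (N : ℕ) (A : Set (V → ℕ)) : Prop :=
  ∀ u, (u ⊓ fun _ => N) ∈ A ↔ u ∈ A

lemma IsTruncated.congr {N : ℕ} {A : Set (V → ℕ)} (h : IsTruncated N A) {u w : V → ℕ}
    (huw : ∀ v, min (u v) N = min (w v) N) : u ∈ A ↔ w ∈ A := by
  rw [← h u, ← h w]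
  exact iff_of_eq (congrArg (· ∈ A) (funext huw))

lemma isTruncated_exponentsOn {N : ℕ} (hN : 0 < N) (W : Set V) :
    IsTruncated N (exponentsOn W) := by
  intro u
  refine forall₂_congr fun v _ => ?_
  simp only [Pi.inf_apply]
  omega

lemma IsTruncated.inter {N : ℕ} {A B : Set (V → ℕ)} (hA : IsTruncated N A)
    (hB : IsTruncated N B) : IsTruncated N (A ∩ B) := fun u => and_congr (hA u) (hB u)

lemma IsTruncated.diff {N : ℕ} {A B : Set (V → ℕ)} (hA : IsTruncated N A)
    (hB : IsTruncated N B) : IsTruncated N (A \ B) :=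
  fun u => and_congr (hA u) (not_congr (hB u))

/-- The fibre of truncation over `a ≤ N` is the cone at `a` whose free directions are the
coordinates where `a` equals `N`; finitely many fibres make up `A`. -/
lemma IsTruncated.hasConePartition_zero [Finite V] {N : ℕ} {A : Set (V → ℕ)}
    (hA : IsTruncated N A) : HasConePartition 0 A := by
  classical
  have := Fintype.ofFinite V
  let Z : (V → ℕ) → Finset V := fun a => Finset.univ.filter fun v => a v = N
  have hcut : ∀ a u : V → ℕ, (a ≤ fun _ => N) → u ∈ exponentCone a (Z a) →
      (u ⊓ fun _ => N) = a := by
    intro a u ha hu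
    funext v
    have h1 : a v ≤ u v := hu.1 v
    have h2 : a v ≤ N := ha v
    simp only [Pi.inf_apply]
    by_cases hv : a v = N
    · omega
    · have := hu.2 v (by simp [Z, hv])
      omega
  have hfin : ({a | a ∈ A ∧ a ≤ fun _ => N} : Set (V → ℕ)).Finite :=
    (Set.finite_Iic (fun _ : V => N)).subset fun a ha => ha.2
  have hU : A = ⋃ a ∈ hfin.toFinset, exponentCone a (Z a) := by
    ext u
    simp only [Set.Finite.mem_toFinset, Set.mem_ofPred_eq, Set.mem_iUnion, exists_prop]
    constructor
    · intro hu
      refine ⟨u ⊓ fun _ => N, ⟨(hA u).2 hu, inf_le_right⟩, inf_le_left, fun v hv => ?_⟩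
      simp only [Z, Finset.mem_filter, Finset.mem_univ, true_and, Pi.inf_apply] at hv
      simp only [Pi.inf_apply]
      omega
    · rintro ⟨a, ⟨ha, haN⟩, hu⟩
      rw [← hA u, hcut a u haN hu]
      exact ha
  rw [hU]
  refine HasConePartition.biUnion _ _ (fun a _ => hasConePartition_cone _ _ (Nat.zero_le _)) ?_
  intro a ha b hb hab
  simp only [Set.Finite.coe_toFinset, Set.mem_ofPred_eq] at ha hb
  rw [Function.onFun, Set.disjoint_left]
  intro u hua hub
  exact hab ((hcut a u ha.2 hua).symm.trans (hcut b u hb.2 hub))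

/-- The base points of the rays in direction `i` in `A` that start at height `m`. -/
def raySlice [DecidableEq V] (A : Set (V → ℕ)) (i : V) (m : ℕ) : Set (V → ℕ) :=
  {w | w i = 0 ∧ w + Pi.single i m ∈ A ∧ ∀ l < m, w + Pi.single i l ∉ A}

lemma raySlice_subset [DecidableEq V] (A : Set (V → ℕ)) (i : V) (m : ℕ) :
    raySlice A i m ⊆ exponentsOn {i}ᶜ := by
  intro w hw v hv
  simp only [Set.mem_compl_iff, Set.mem_singleton_iff, not_not] at hv
  rw [hv, hw.1]

lemma IsTruncated.raySlice [DecidableEq V] {N : ℕ} {A : Set (V → ℕ)} (hA : IsTruncated N A)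
    (hN : 0 < N) (i : V) (m : ℕ) : IsTruncated N (raySlice A i m) := by
  intro w
  have key : w i = 0 → ∀ l, (w ⊓ fun _ => N) + Pi.single i l ∈ A ↔ w + Pi.single i l ∈ A := by
    intro hw l
    apply hA.congr
    intro v
    by_cases hv : v = i
    · subst hv; simp [hw]
    · simp [hv]
  have h0 : (w ⊓ fun _ => N) i = 0 ↔ w i = 0 := by
    simp only [Pi.inf_apply]
    omega
  constructor
  · rintro ⟨h1, h2⟩
    rw [h0] at h1
    simp only [key h1] at h2
    exact ⟨h1, h2⟩
  · rintro ⟨h1, h2⟩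
    refine ⟨h0.2 h1, ?_⟩
    simpa only [key h1] using h2

/-- A set that is closed under increasing the `i`-th exponent is partitioned by partitioning the
sets of base points of its rays in direction `i`. -/
lemma HasConePartition.of_raySlice [DecidableEq V] {N d : ℕ} {A : Set (V → ℕ)}
    (hA : IsTruncated N A) (i : V) (hi : ∀ u ∈ A, u + Pi.single i 1 ∈ A)
    (h : ∀ m, HasConePartition d (raySlice A i m)) : HasConePartition (d + 1) A := by
  have hi' : ∀ u ∈ A, ∀ c, u + Pi.single i c ∈ A := by
    intro u hu c
    induction c with
    | zero => simpa using hu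
    | succ c ih =>
      have := hi _ ih
      rwa [add_assoc, ← Pi.single_add] at this
  have hcone : ∀ m, exponentCone (Pi.single i m) {i} ⊆ exponentsOn {i} := by
    intro m u hu v hv
    rw [hu.2 v (by simpa using hv)]
    simp only [Set.mem_singleton_iff] at hv
    simp [hv]
  have hdisW : Disjoint ({i}ᶜ : Set V) {i} := disjoint_compl_left
  have hU : A = ⋃ m ∈ Finset.range (N + 1),
      (raySlice A i m + exponentCone (Pi.single i m) {i}) := by
    ext u
    simp only [Finset.mem_range, Set.mem_iUnion, exists_prop]
    constructor
    · intro hu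
      have hsplit : Function.update u i 0 + Pi.single i (u i) = u := by
        funext v
        by_cases hv : v = i
        · subst hv; simp
        · simp [hv]
      have hex : ∃ l, Function.update u i 0 + Pi.single i l ∈ A := ⟨u i, by rwa [hsplit]⟩
      classical
      have hle : Nat.find hex ≤ u i := Nat.find_min' hex (by rwa [hsplit])
      -- Truncation does not distinguish heights from `N` on, so a ray that enters `A` above `N`
      -- already has its point at height `N` in `A`.
      have hleN : Nat.find hex ≤ N := by
        by_contra hlt
        push Not at hlt
        refine Nat.find_min hex hlt ?_
        refine (hA.congr ?_).1 (Nat.find_spec hex)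
        intro v
        by_cases hv : v = i
        · subst hv
          simp only [Pi.add_apply, Function.update_self, Pi.single_eq_same]
          omega
        · simp [hv]
      refine ⟨Nat.find hex, by omega, Function.update u i 0,
        ⟨by simp, Nat.find_spec hex, fun l hl => Nat.find_min hex hl⟩, Pi.single i (u i),
        ⟨?_, ?_⟩, hsplit⟩
      · exact Pi.single_le_single.2 hle
      · intro v hv
        simp only [Finset.mem_singleton] at hv
        simp [hv]
    · rintro ⟨m, -, w, hw, x, hx, rfl⟩
      have hxm : x = Pi.single i m + Pi.single i (x i - m) := by
        funext v
        by_cases hv : v = i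
        · subst hv
          have := hx.1 v
          simp only [Pi.single_eq_same] at this
          simp only [Pi.add_apply, Pi.single_eq_same]
          omega
        · simp [hv, hx.2 v (by simpa using hv)]
      simp only
      rw [hxm, ← add_assoc]
      exact hi' _ hw.2.1 _
  rw [hU]
  refine HasConePartition.biUnion _ _ (fun m _ => (h m).add hdisW
    (hasConePartition_cone _ _ (by simp)) (raySlice_subset A i m) (hcone m)) ?_
  intro m _ l _ hml
  refine disjoint_add_of_left hdisW (raySlice_subset A i m) (raySlice_subset A i l) (hcone m)
    (hcone l) ?_
  rw [Set.disjoint_left]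
  intro w hm hl
  rcases lt_or_gt_of_ne hml with hlt | hlt
  · exact hl.2.2 _ hlt hm.2.1
  · exact hm.2.2 _ hlt hl.2.1

/-- An order-convex set each of whose points lies on an infinite ray inside the set has a partition
into cones of positive dimension. -/
lemma IsTruncated.hasConePartition_one [Finite V] [DecidableEq V] {N : ℕ} (hN : 0 < N)
    {A : Set (V → ℕ)} (hA : IsTruncated N A) (hconv : A.OrdConnected)
    (hray : ∀ u ∈ A, ∃ v, ∀ c, u + Pi.single v c ∈ A) : HasConePartition 1 A := by
  have := Fintype.ofFinite V
  let free : V → Set (V → ℕ) := fun v => {u | ∀ c, u + Pi.single v c ∈ A}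
  have htrunc : ∀ v, IsTruncated N (free v) := by
    intro v u
    refine forall_congr' fun c => hA.congr fun w => ?_
    simp only [Pi.add_apply, Pi.inf_apply]
    omega
  have hfreeA : ∀ v, free v ⊆ A := fun v u hu => by simpa using hu 0
  -- Directions are added one at a time: the points free in direction `i` but in no earlier
  -- direction are sliced along `i`, and arbitrary cones on the slices suffice.
  have key : ∀ s : Finset V, HasConePartition 1 (⋃ v ∈ s, free v) := by
    intro s
    induction s using Finset.induction_on with
    | empty => simpa using HasConePartition.empty
    | insert i s _ ih =>
      rw [Finset.set_biUnion_insert, Set.union_comm, ← Set.union_sdiff_self]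
      refine ih.union ?_ Set.disjoint_sdiff_right
      have htr : IsTruncated N (free i \ ⋃ v ∈ s, free v) := by
        refine (htrunc i).diff fun u => ?_
        simp only [Set.mem_iUnion, htrunc _ u]
      refine HasConePartition.of_raySlice htr i ?_
        fun m => (htr.raySlice hN i m).hasConePartition_zero
      rintro u ⟨hu, hus⟩
      refine ⟨fun c => ?_, fun hmem => hus ?_⟩
      · rw [add_assoc, ← Pi.single_add]
        exact hu _
      · simp only [Set.mem_iUnion, exists_prop] at hmem ⊢
        obtain ⟨v, hv, hfree⟩ := hmem
        -- If `u + e_i` is free in direction `v`, then `u + c e_v` lies between `u` and `u + e_i + c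
        -- e_v`, both in `A`; convexity makes `u` free in direction `v` too.
        refine ⟨v, hv, fun c => hconv.out (hfreeA i hu) (hfree c) ⟨le_self_add, ?_⟩⟩
        rw [add_right_comm]
        exact le_self_add
  have hU : A = ⋃ v ∈ (Finset.univ : Finset V), free v := by
    refine Set.Subset.antisymm (fun u hu => ?_) (by simpa using hfreeA)
    obtain ⟨v, hv⟩ := hray u hu
    simp only [Finset.mem_univ, Set.iUnion_true, Set.mem_iUnion]
    exact ⟨v, hv⟩
  rw [hU]
  exact key _

lemma add_single_mem_exponentsOn [DecidableEq V] {W : Set V} {u : V → ℕ} (hu : u ∈ exponentsOn W)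
    {v : V} (hv : v ∈ W) (c : ℕ) : u + Pi.single v c ∈ exponentsOn W := by
  intro w hw
  have : w ≠ v := by rintro rfl; exact hw hv
  simp [this, hu w hw]

lemma isLowerSet_exponentsOn (W : Set V) : IsLowerSet (exponentsOn W) :=
  fun _ _ hwu hu v hv => Nat.eq_zero_of_le_zero ((hwu v).trans (hu v hv).le)

/-- If the quotient by a monomial ideal in at least two variables has positive depth, then the
ideal has a partition into cones of dimension at least two. -/
lemma IsUpperSet.hasConePartition_two [Finite V] [DecidableEq V] {N : ℕ} (hN : 0 < N)
    {U : Set (V → ℕ)} (hU : IsUpperSet U) (htr : IsTruncated N U) {W : Set V}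
    (hW : W.Nontrivial)
    (hray : ∀ u ∈ exponentsOn W, u ∉ U → ∃ v ∈ W, ∀ c, u + Pi.single v c ∉ U) :
    HasConePartition 2 (U ∩ exponentsOn W) := by
  obtain ⟨i, hi, i', hi', hne⟩ := hW
  have htrA : IsTruncated N (U ∩ exponentsOn W) := htr.inter (isTruncated_exponentsOn hN W)
  refine HasConePartition.of_raySlice htrA i
    (fun u hu => ⟨hU le_self_add hu.1, add_single_mem_exponentsOn hu.2 hi 1⟩) fun m => ?_
  refine (htrA.raySlice hN i m).hasConePartition_one hN ⟨?_⟩ ?_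
  · rintro x ⟨hx, hxA, hxl⟩ z ⟨hz, hzA, hzl⟩ y ⟨hxy, hyz⟩
    have hyW : ∀ l, y + Pi.single i l ∈ exponentsOn W := fun l =>
      add_single_mem_exponentsOn
        (isLowerSet_exponentsOn W (hyz.trans le_self_add) hzA.2) hi l
    refine ⟨Nat.eq_zero_of_le_zero ((hyz i).trans hz.le),
      ⟨hU (by gcongr) hxA.1, hyW m⟩, fun l hl hmem => hzl l hl ⟨?_, ?_⟩⟩
    · exact hU (by gcongr) hmem.1
    · exact add_single_mem_exponentsOn
        (isLowerSet_exponentsOn W le_self_add hzA.2) hi l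
  · rintro u ⟨hu, huA, hul⟩
    have huW : u ∈ exponentsOn W := isLowerSet_exponentsOn W le_self_add huA.2
    have hup : ∀ v c, u + Pi.single v c + Pi.single i m ∈ U := fun v c =>
      hU (by gcongr; exact le_self_add) huA.1
    -- At height 0 the base point is already in `U`, so any second direction is free. At height `m +
    -- 1` the point at height `m` is outside `U`; its escaping direction differs from `i`, since one
    -- more step along `i` enters `U`, and it keeps all lower heights outside `U`.
    rcases m with _ | m
    · refine ⟨i', fun c => ⟨by simp [hu, hne], ⟨hup _ _, ?_⟩, by simp⟩⟩
      exact add_single_mem_exponentsOn (add_single_mem_exponentsOn huW hi' c) hi _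
    · have hm : u + Pi.single i m ∈ exponentsOn W := add_single_mem_exponentsOn huW hi m
      obtain ⟨v, hv, hfree⟩ := hray _ hm fun h => hul m (by omega) ⟨h, hm⟩
      have hvi : i ≠ v := by
        rintro rfl
        refine hfree 1 ?_
        rw [add_assoc, ← Pi.single_add]
        exact huA.1
      refine ⟨v, fun c => ⟨by simp [hu, hvi], ⟨hup _ _, ?_⟩, fun l hl hmem => hfree c ?_⟩⟩
      · exact add_single_mem_exponentsOn (add_single_mem_exponentsOn huW hv c) hi _
      · refine hU ?_ hmem.1
        rw [add_right_comm]
        gcongr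
        omega

end ConePartitions

/-! ### Powers of the edge ideal and vertex covers. -/

section EdgeIdealPowers

variable {V : Type*} [DecidableEq V] {G : SimpleGraph V}

/-- The exponent vectors of the monomials in the `k`-th power of the edge ideal of `G`. -/
def edgePowerExponents (G : SimpleGraph V) : ℕ → Set (V → ℕ)
  | 0 => Set.univ
  | k + 1 => {u | ∃ i j w, G.Adj i j ∧ w ∈ edgePowerExponents G k ∧
      u = w + (Pi.single i 1 + Pi.single j 1)}

lemma isUpperSet_edgePowerExponents (k : ℕ) : IsUpperSet (edgePowerExponents G k) := by
  cases k with
  | zero => exact isUpperSet_univ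
  | succ k =>
    rintro u u' huu' ⟨i, j, w, hij, hw, rfl⟩
    refine ⟨i, j, w + (u' - (w + (Pi.single i 1 + Pi.single j 1))), hij,
      isUpperSet_edgePowerExponents k le_self_add hw, ?_⟩
    rw [add_right_comm, add_tsub_cancel_of_le huu']

lemma antitone_edgePowerExponents : Antitone (edgePowerExponents G) := by
  refine antitone_nat_of_succ_le fun k => ?_
  rintro u ⟨i, j, w, hij, hw, rfl⟩
  exact isUpperSet_edgePowerExponents k le_self_add hw

lemma add_mem_edgePowerExponents {k l : ℕ} {u w : V → ℕ} (hu : u ∈ edgePowerExponents G k)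
    (hw : w ∈ edgePowerExponents G l) : u + w ∈ edgePowerExponents G (k + l) := by
  induction l generalizing w with
  | zero => exact isUpperSet_edgePowerExponents k le_self_add hu
  | succ l ih =>
    obtain ⟨i, j, w, hij, hw, rfl⟩ := hw
    exact ⟨i, j, u + w, hij, ih hw, by rw [add_assoc]⟩

lemma isTruncated_edgePowerExponents {k N : ℕ} (h : 2 * k ≤ N) :
    IsTruncated N (edgePowerExponents G k) := by
  refine fun u => ⟨fun hu => isUpperSet_edgePowerExponents k inf_le_left hu, fun hu => ?_⟩
  induction k generalizing u N with
  | zero => trivial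
  | succ k ih =>
    obtain ⟨i, j, w, hij, hw, rfl⟩ := hu
    -- An edge adds at most `1 + 1` to any one exponent, by the crude bound on its two ends.
    have := ih (N := N - 2) (by omega) w hw
    refine isUpperSet_edgePowerExponents (k + 1) (fun v => ?_) ⟨i, j, _, hij, this, rfl⟩
    have h1 : (Pi.single i 1 : V → ℕ) v ≤ 1 := by
      rw [Pi.single_apply]; split_ifs <;> omega
    have h2 : (Pi.single j 1 : V → ℕ) v ≤ 1 := by
      rw [Pi.single_apply]; split_ifs <;> omega
    simp only [Pi.add_apply, Pi.inf_apply]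
    omega

/-- No edge crosses between `W` and its complement, so the `k` edge factors are sorted by side. -/
lemma exists_indicator_mem_edgePowerExponents {W : Set V} (hW : ∀ i j, G.Adj i j → (i ∈ W ↔ j ∈ W))
    {k : ℕ} {u : V → ℕ} (hu : u ∈ edgePowerExponents G k) :
    ∃ j l, j + l = k ∧ W.indicator u ∈ edgePowerExponents G j ∧
      Wᶜ.indicator u ∈ edgePowerExponents G l := by
  induction k generalizing u with
  | zero => exact ⟨0, 0, rfl, trivial, trivial⟩
  | succ k ih =>
    obtain ⟨x, y, w, hxy, hw, rfl⟩ := hu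
    obtain ⟨j, l, hjl, h1, h2⟩ := ih hw
    have hind : ∀ (T : Set V) (v : V), v ∈ T →
        T.indicator (Pi.single v 1 : V → ℕ) = Pi.single v 1 := by
      intro T v hv
      refine Set.indicator_eq_self.2 fun z hz => ?_
      by_cases hzv : z = v
      · rwa [hzv]
      · simp [hzv] at hz
    have hle : ∀ T : Set V, T.indicator w ≤ T.indicator (w + (Pi.single x 1 + Pi.single y 1)) :=
      fun T v => Set.indicator_le_indicator' fun _ => le_self_add
    by_cases hx : x ∈ W
    · refine ⟨j + 1, l, by omega, ⟨x, y, _, hxy, h1, ?_⟩,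
        isUpperSet_edgePowerExponents l (hle _) h2⟩
      rw [Set.indicator_add', Set.indicator_add', hind W x hx, hind W y ((hW x y hxy).1 hx)]
    · refine ⟨j, l + 1, by omega, isUpperSet_edgePowerExponents j (hle _) h1,
        ⟨x, y, _, hxy, h2, ?_⟩⟩
      rw [Set.indicator_add', Set.indicator_add', hind Wᶜ x hx,
        hind Wᶜ y (fun hy => hx ((hW x y hxy).2 hy))]

lemma sum_single_mem_edgePowerExponents {ι : Type*} (s : Finset ι) (x y : ι → V)
    (h : ∀ p ∈ s, G.Adj (x p) (y p)) :
    ∑ p ∈ s, (Pi.single (x p) 1 + Pi.single (y p) 1 : V → ℕ) ∈ edgePowerExponents G s.card := by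
  classical
  induction s using Finset.induction_on with
  | empty => trivial
  | insert p s hp ih =>
    rw [Finset.sum_insert hp, Finset.card_insert_of_notMem hp]
    exact ⟨x p, y p, _, h p (by simp), ih fun q hq => h q (by simp [hq]), add_comm _ _⟩

/-- `C` meets every edge of `G`. -/
def SimpleGraph.IsFinsetCover (G : SimpleGraph V) (C : Finset V) : Prop :=
  ∀ i j, G.Adj i j → i ∈ C ∨ j ∈ C

/-- The easy half of König duality: each edge factor adds at least one to the weight of a cover. -/
lemma SimpleGraph.IsFinsetCover.le_sum {C : Finset V} (hC : G.IsFinsetCover C) {k : ℕ}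
    {u : V → ℕ} (hu : u ∈ edgePowerExponents G k) : k ≤ ∑ v ∈ C, u v := by
  induction k generalizing u with
  | zero => exact Nat.zero_le _
  | succ k ih =>
    obtain ⟨x, y, w, hxy, hw, rfl⟩ := hu
    have := ih hw
    simp only [Pi.add_apply, Finset.sum_add_distrib, Finset.sum_pi_single']
    rcases hC x y hxy with h | h <;> simp only [h, if_true] <;> omega

/-- Weighted König theorem: if every vertex cover of a bipartite graph has `u`-weight at least `k`,
then `u` dominates a sum of `k` edges. -/
lemma mem_edgePowerExponents_of_cover [Fintype V] {X : Set V}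
    (hX : ∀ i j, G.Adj i j → (i ∈ X ↔ j ∉ X)) {k : ℕ} {u : V → ℕ}
    (h : ∀ C, G.IsFinsetCover C → k ≤ ∑ v ∈ C, u v) : u ∈ edgePowerExponents G k := by
  classical
  let L : Finset V := Finset.univ.filter (· ∈ X)
  have hL : ∀ v, v ∈ L ↔ v ∈ X := fun v => by simp [L]
  -- Each vertex `v` is replaced by `u v` copies; `ι` consists of the copies on the side `X`.
  let ι := {p : Σ v, Fin (u v) // p.1 ∈ X}
  let blow : Finset V → Finset (Σ v, Fin (u v)) := fun C => C.sigma fun _ => Finset.univ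
  have hblow : ∀ C, (blow C).card = ∑ v ∈ C, u v := fun C => by simp [blow]
  have hmem : ∀ C p, p ∈ blow C ↔ p.1 ∈ C := fun C p => by simp [blow]
  have hι : Fintype.card ι = ∑ v ∈ L, u v := by
    rw [← hblow, Fintype.card_subtype]
    congr 1
    ext p
    simp [hmem, hL]
  have hkL : k ≤ ∑ v ∈ L, u v := by
    refine h L fun i j hij => ?_
    rw [hL, hL, hX i j hij]
    tauto
  -- Deficiency form of Hall's theorem: `d` dummy partners adjacent to every left copy absorb the
  -- shortfall, leaving at least `k` left copies matched along genuine edges.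
  obtain ⟨d, hd⟩ := Nat.exists_eq_add_of_le hkL
  let t : ι → Finset ((Σ v, Fin (u v)) ⊕ Fin d) := fun p =>
    (blow (Finset.univ.filter fun y => G.Adj p.1.1 y)).disjSum Finset.univ
  have hall : ∀ s : Finset ι, s.card ≤ (s.biUnion t).card := by
    intro s
    rcases s.eq_empty_or_nonempty with rfl | ⟨p₀, hp₀⟩
    · simp
    let T : Finset V := s.image fun p => p.1.1
    let Y : Finset V := Finset.univ.filter fun y => ∃ x ∈ T, G.Adj x y
    have hTL : T ⊆ L := by
      intro v hv
      obtain ⟨p, -, rfl⟩ := Finset.mem_image.1 hv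
      exact (hL _).2 p.2
    -- Hall's condition for `s` is the weight bound for the cover that replaces the vertices `T`
    -- under `s` by their neighbours `Y`.
    have hcov : G.IsFinsetCover ((L \ T) ∪ Y) := by
      have aux : ∀ i j, G.Adj i j → i ∈ X → i ∈ (L \ T) ∪ Y ∨ j ∈ (L \ T) ∪ Y := by
        intro i j hij hi
        by_cases hiT : i ∈ T
        · exact Or.inr (Finset.mem_union_right _
            (Finset.mem_filter.2 ⟨Finset.mem_univ _, i, hiT, hij⟩))
        · exact Or.inl (Finset.mem_union_left _ (Finset.mem_sdiff.2 ⟨(hL i).2 hi, hiT⟩))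
      intro i j hij
      by_cases hi : i ∈ X
      · exact aux i j hij hi
      · exact (aux j i hij.symm ((hX j i hij.symm).2 hi)).symm
    have h1 : k ≤ ∑ v ∈ L \ T, u v + ∑ v ∈ Y, u v :=
      (h _ hcov).trans (by rw [← Finset.sum_union_inter]; exact Nat.le_add_right _ _)
    have h2 : s.card ≤ ∑ v ∈ T, u v := by
      rw [← hblow]
      refine Finset.card_le_card_of_injOn (fun p => p.1) (fun p hp => ?_)
        Subtype.val_injective.injOn
      exact (hmem _ _).2 (Finset.mem_image_of_mem _ hp)
    have h3 : ∑ v ∈ L \ T, u v + ∑ v ∈ T, u v = ∑ v ∈ L, u v := Finset.sum_sdiff hTL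
    have h4 : ∑ v ∈ Y, u v + d ≤ (s.biUnion t).card := by
      have : (blow Y).disjSum (Finset.univ : Finset (Fin d)) ⊆ s.biUnion t := by
        rintro (q | q) hq
        · simp only [Finset.inl_mem_disjSum, hmem, Y, T, Finset.mem_filter, Finset.mem_univ,
            true_and, Finset.mem_image] at hq
          obtain ⟨_, ⟨p, hp, rfl⟩, hadj⟩ := hq
          exact Finset.mem_biUnion.2 ⟨p, hp, by simp [t, hmem, hadj]⟩
        · exact Finset.mem_biUnion.2 ⟨p₀, hp₀, by simp [t]⟩
      have := Finset.card_le_card this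
      rwa [Finset.card_disjSum, hblow, Finset.card_univ, Fintype.card_fin] at this
    omega
  obtain ⟨f, hf, hft⟩ := (Finset.all_card_le_biUnion_card_iff_exists_injective t).1 hall
  let M : Finset ι := Finset.univ.filter fun p => (f p).isLeft
  have hM : k ≤ M.card := by
    have h1 : (Finset.univ.filter fun p => ¬ (f p).isLeft).card ≤ d := by
      have : (Finset.univ.map (Function.Embedding.inr :
          Fin d ↪ (Σ v, Fin (u v)) ⊕ Fin d)).card = d := by simp
      refine (Finset.card_le_card_of_injOn f (fun p hp => ?_) hf.injOn).trans this.le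
      simp only [Finset.coe_filter, Finset.mem_univ, true_and, Set.mem_ofPred_eq] at hp
      rcases hfp : f p with q | q
      · simp [hfp] at hp
      · simp
    have h2 := Finset.card_filter_add_card_filter_not (s := Finset.univ)
      (fun p : ι => ((f p).isLeft : Prop))
    rw [Finset.card_univ, hι] at h2
    change M.card + _ = _ at h2
    omega
  let y : ι → V := fun p => Sum.elim (fun q => q.1) (fun _ => p.1.1) (f p)
  have hadj : ∀ p ∈ M, ∃ q, f p = Sum.inl q ∧ y p = q.1 ∧ G.Adj p.1.1 q.1 := by
    intro p hp
    have h1 := hft p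
    simp only [M, Finset.mem_filter, Finset.mem_univ, true_and] at hp
    rcases hfp : f p with q | q
    · rw [hfp] at h1
      refine ⟨q, rfl, by simp [y, hfp], ?_⟩
      simpa [t, hmem] using h1
    · simp [hfp] at hp
  have hsum := sum_single_mem_edgePowerExponents (G := G) M (fun p => p.1.1) y (fun p hp => by
    obtain ⟨q, -, hq, hpq⟩ := hadj p hp
    rwa [hq])
  refine isUpperSet_edgePowerExponents k (fun v => ?_) (antitone_edgePowerExponents hM hsum)
  have hcount : ∀ x : ι → V, ∑ p ∈ M, (Pi.single (x p) 1 : V → ℕ) v =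
      (M.filter fun p => x p = v).card := by
    intro x
    simp only [Pi.single_apply, Finset.card_filter, eq_comm]
  simp only [Finset.sum_apply, Pi.add_apply, Finset.sum_add_distrib, hcount]
  -- Only one end of the chosen edges can equal `v`, according to its side, and injectivity bounds
  -- the count by the `u v` copies of `v`.
  have huv : u v = (blow {v}).card := by simp [hblow]
  by_cases hv : v ∈ X
  · have h0 : (M.filter fun p => y p = v) = ∅ := by
      refine Finset.filter_eq_empty_iff.2 fun p hp hpv => ?_
      obtain ⟨q, -, hq, hpq⟩ := hadj p hp
      exact (hX _ _ hpq).1 p.2 (by rwa [← hq, hpv])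
    rw [h0, Finset.card_empty, add_zero, huv]
    refine Finset.card_le_card_of_injOn (fun p => p.1) (fun p hp => ?_)
      Subtype.val_injective.injOn
    simp only [Finset.coe_filter, Set.mem_ofPred_eq] at hp
    exact (hmem _ _).2 (by simp [hp.2])
  · have h0 : (M.filter fun p => p.1.1 = v) = ∅ :=
      Finset.filter_eq_empty_iff.2 fun p _ hpv => hv (hpv ▸ p.2)
    rw [h0, Finset.card_empty, zero_add, huv, ← Finset.card_map (Function.Embedding.inl :
          _ ↪ (Σ v, Fin (u v)) ⊕ Fin d)]
    refine Finset.card_le_card_of_injOn f (fun p hp => ?_) hf.injOn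
    simp only [Finset.coe_filter, Set.mem_ofPred_eq] at hp
    obtain ⟨q, hfq, hq, -⟩ := hadj p hp.1
    simp [hfq, hmem, ← hq, hp.2]

/-- On every nonempty set of vertices of a bipartite graph, the quotient by a power of the edge
ideal has positive depth. -/
lemma exists_ray_notMem_edgePowerExponents [Finite V] {X : Set V}
    (hX : ∀ i j, G.Adj i j → (i ∈ X ↔ j ∉ X)) {W : Set V} (hW : W.Nonempty) {k : ℕ} {u : V → ℕ}
    (hu : u ∈ exponentsOn W) (huk : u ∉ edgePowerExponents G k) :
    ∃ v ∈ W, ∀ c, u + Pi.single v c ∉ edgePowerExponents G k := by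
  classical
  have := Fintype.ofFinite V
  have key : ∀ C, G.IsFinsetCover C → ∑ v ∈ C, u v < k → ∀ v, v ∉ C →
      ∀ c, u + Pi.single v c ∉ edgePowerExponents G k := by
    intro C hC hlt v hv c hmem
    have := hC.le_sum hmem
    simp only [Pi.add_apply, Finset.sum_add_distrib, Finset.sum_pi_single', hv, if_false] at this
    omega
  have hex : ∃ C, G.IsFinsetCover C ∧ ∑ v ∈ C, u v < k := by
    by_contra! hall
    exact huk (mem_edgePowerExponents_of_cover hX hall)
  obtain ⟨C, hC, hlt⟩ := hex
  by_cases hWC : ∃ v ∈ W, v ∉ C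
  · obtain ⟨v, hv, hvC⟩ := hWC
    exact ⟨v, hv, key C hC hlt v hvC⟩
  push Not at hWC
  -- Here the cover contains the support of `u`, so the total weight is below `k` and any cover will
  -- do; the colour class avoiding `v` is one.
  have htot : ∀ D : Finset V, ∑ v ∈ D, u v < k := by
    intro D
    refine lt_of_le_of_lt ?_ hlt
    refine Finset.sum_le_sum_of_ne_zero fun v _ hv => hWC v ?_
    by_contra hvW
    exact hv (hu v hvW)
  obtain ⟨v, hv⟩ := hW
  refine ⟨v, hv, ?_⟩
  by_cases hvX : v ∈ X
  · refine key (Finset.univ.filter (· ∉ X)) (fun i j hij => ?_) (htot _) v (by simpa using hvX)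
    simp only [Finset.mem_filter, Finset.mem_univ, true_and, hX i j hij]
    tauto
  · refine key (Finset.univ.filter (· ∈ X)) (fun i j hij => ?_) (htot _) v (by simpa using hvX)
    simp only [Finset.mem_filter, Finset.mem_univ, true_and, hX i j hij]
    tauto

end EdgeIdealPowers

/-! ### Orders of monomials and the splitting over components. -/

section Components

variable {V : Type*} {G : SimpleGraph V}

lemma indicator_mem_exponentsOn_left (W : Set V) (u : V → ℕ) :
    W.indicator u ∈ exponentsOn W := fun _ hv => Set.indicator_of_notMem hv u

lemma indicator_compl_mem_exponentsOn {W W' : Set V} {u : V → ℕ}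
    (hu : u ∈ exponentsOn (W ∪ W')) : Wᶜ.indicator u ∈ exponentsOn W' := by
  intro v hv
  by_cases hvW : v ∈ W
  · exact Set.indicator_of_notMem (by simpa using hvW) u
  · rw [Set.indicator_of_mem (by exact hvW)]
    exact hu v (by simp [hvW, hv])

lemma add_mem_exponentsOn_union {W W' : Set V} {u w : V → ℕ} (hu : u ∈ exponentsOn W)
    (hw : w ∈ exponentsOn W') : w + u ∈ exponentsOn (W ∪ W') := by
  intro v hv
  simp only [Set.mem_union, not_or] at hv
  simp [hu v hv.1, hw v hv.2]

variable [DecidableEq V]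

lemma exists_level_of_notMem {k : ℕ} {u : V → ℕ} (hu : u ∉ edgePowerExponents G k) :
    ∃ j < k, u ∈ edgePowerExponents G j \ edgePowerExponents G (j + 1) := by
  induction k with
  | zero => exact absurd trivial hu
  | succ k ih =>
    by_cases hk : u ∈ edgePowerExponents G k
    · exact ⟨k, by omega, hk, hu⟩
    · obtain ⟨j, hj, h⟩ := ih hk
      exact ⟨j, by omega, h⟩

lemma level_eq_of_mem {j l : ℕ} {u : V → ℕ} (hj : u ∈ edgePowerExponents G j)
    (hl : u ∉ edgePowerExponents G (l + 1)) : j ≤ l := by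
  by_contra h
  exact hl (antitone_edgePowerExponents (by omega) hj)

lemma pairwiseDisjoint_levels (s : Set ℕ) : s.PairwiseDisjoint fun j =>
    edgePowerExponents G j \ edgePowerExponents G (j + 1) := by
  intro j _ l _ hjl
  rw [Function.onFun, Set.disjoint_left]
  intro u hj hl
  exact hjl (le_antisymm (level_eq_of_mem hj.1 hl.2) (level_eq_of_mem hl.1 hj.2))

lemma exists_mem_edgePowerExponents_of_add {W W' : Set V} (hdis : Disjoint W W')
    (hW : ∀ i j, G.Adj i j → (i ∈ W ↔ j ∈ W)) {k : ℕ} {u w : V → ℕ} (hu : u ∈ exponentsOn W)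
    (hw : w ∈ exponentsOn W') (h : w + u ∈ edgePowerExponents G k) :
    ∃ j l, j + l = k ∧ u ∈ edgePowerExponents G j ∧ w ∈ edgePowerExponents G l := by
  obtain ⟨j, l, hjl, h1, h2⟩ := exists_indicator_mem_edgePowerExponents hW h
  have hadd : w + u = Wᶜ.indicator (w + u) + W.indicator (w + u) :=
    (Set.indicator_compl_add_self W (w + u)).symm
  have := add_eq_add_of_mem_exponentsOn hdis.symm hw
    (indicator_compl_mem_exponentsOn (add_mem_exponentsOn_union hu hw)) hu
    (indicator_mem_exponentsOn_left W _) hadd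
  exact ⟨j, l, hjl, by rwa [this.2], by rwa [this.1]⟩

/-- A `W'`-part of order `j < k` needs a `W`-part in the power `k - j`; a `W'`-part already in the
`k`-th power allows any `W`-part. Different orders give disjoint pieces. -/
lemma hasConePartition_union_of_levels {W W' : Set V} {d e : ℕ} (hdis : Disjoint W W')
    (hW : ∀ i j, G.Adj i j → (i ∈ W ↔ j ∈ W))
    (hlevel : ∀ j, HasConePartition d
      ((edgePowerExponents G j \ edgePowerExponents G (j + 1)) ∩ exponentsOn W'))
    (hupper' : ∀ k, HasConePartition d (edgePowerExponents G k ∩ exponentsOn W'))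
    (hupper : ∀ k, HasConePartition e (edgePowerExponents G k ∩ exponentsOn W)) (k : ℕ) :
    HasConePartition (d + e) (edgePowerExponents G k ∩ exponentsOn (W ∪ W')) := by
  have hU : edgePowerExponents G k ∩ exponentsOn (W ∪ W') =
      (⋃ j ∈ Finset.range k,
        ((edgePowerExponents G j \ edgePowerExponents G (j + 1)) ∩ exponentsOn W' +
          edgePowerExponents G (k - j) ∩ exponentsOn W)) ∪
      (edgePowerExponents G k ∩ exponentsOn W' +
        edgePowerExponents G 0 ∩ exponentsOn W) := by
    ext x
    simp only [Finset.mem_range, Set.mem_union, Set.mem_iUnion, exists_prop]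
    constructor
    · rintro ⟨hx, hxW⟩
      have h1 := indicator_mem_exponentsOn_left W x
      have h2 := indicator_compl_mem_exponentsOn hxW
      have hadd : Wᶜ.indicator x + W.indicator x = x := Set.indicator_compl_add_self W x
      rw [← hadd] at hx ⊢
      by_cases hk : Wᶜ.indicator x ∈ edgePowerExponents G k
      · exact Or.inr (Set.add_mem_add ⟨hk, h2⟩ ⟨trivial, h1⟩)
      · obtain ⟨j, hj, hmem⟩ := exists_level_of_notMem hk
        obtain ⟨a, b, hab, ha, hb⟩ := exists_mem_edgePowerExponents_of_add hdis hW h1 h2 hx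
        have := level_eq_of_mem hb hmem.2
        exact Or.inl ⟨j, hj, Set.add_mem_add ⟨hmem, h2⟩
          ⟨antitone_edgePowerExponents (by omega) ha, h1⟩⟩
    · rintro (⟨j, hj, w, ⟨hw, hw'⟩, u, ⟨hu, hu'⟩, rfl⟩ | ⟨w, ⟨hw, hw'⟩, u, ⟨hu, hu'⟩, rfl⟩)
      · refine ⟨?_, add_mem_exponentsOn_union hu' hw'⟩
        have := add_mem_edgePowerExponents hw.1 hu
        rwa [Nat.add_sub_cancel' hj.le] at this
      · exact ⟨add_mem_edgePowerExponents hw hu, add_mem_exponentsOn_union hu' hw'⟩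
  rw [hU]
  refine HasConePartition.union (HasConePartition.biUnion _ _ (fun j _ =>
    (hlevel j).add hdis.symm (hupper _) Set.inter_subset_right Set.inter_subset_right) ?_)
    ((hupper' k).add hdis.symm (hupper 0) Set.inter_subset_right Set.inter_subset_right) ?_
  · intro j hj l hl hjl
    exact disjoint_add_of_left hdis.symm Set.inter_subset_right Set.inter_subset_right
      Set.inter_subset_right Set.inter_subset_right
      ((pairwiseDisjoint_levels _ hj hl hjl).mono Set.inter_subset_left Set.inter_subset_left)
  · rw [Set.disjoint_iUnion₂_left]
    intro j hj
    refine disjoint_add_of_left hdis.symm Set.inter_subset_right Set.inter_subset_right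
      Set.inter_subset_right Set.inter_subset_right ?_
    rw [Set.disjoint_left]
    intro u hu hu'
    have := level_eq_of_mem hu'.1 hu.1.2
    have := Finset.mem_range.1 hj
    omega

/-- By additivity of the order, a `W'`-part of order `j` forces the `W`-part to have order exactly
`k - j`. -/
lemma hasConePartition_level_union {W W' : Set V} {d e : ℕ} (hdis : Disjoint W W')
    (hW : ∀ i j, G.Adj i j → (i ∈ W ↔ j ∈ W))
    (hlevel : ∀ j, HasConePartition d
      ((edgePowerExponents G j \ edgePowerExponents G (j + 1)) ∩ exponentsOn W'))
    (hlevel' : ∀ j, HasConePartition e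
      ((edgePowerExponents G j \ edgePowerExponents G (j + 1)) ∩ exponentsOn W)) (k : ℕ) :
    HasConePartition (d + e)
      ((edgePowerExponents G k \ edgePowerExponents G (k + 1)) ∩ exponentsOn (W ∪ W')) := by
  have hU : (edgePowerExponents G k \ edgePowerExponents G (k + 1)) ∩ exponentsOn (W ∪ W') =
      ⋃ j ∈ Finset.range (k + 1),
        ((edgePowerExponents G j \ edgePowerExponents G (j + 1)) ∩ exponentsOn W' +
          (edgePowerExponents G (k - j) \ edgePowerExponents G (k - j + 1)) ∩ exponentsOn W) := by
    ext x
    simp only [Finset.mem_range, Set.mem_iUnion, exists_prop]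
    constructor
    · rintro ⟨⟨hx, hx'⟩, hxW⟩
      have h1 := indicator_mem_exponentsOn_left W x
      have h2 := indicator_compl_mem_exponentsOn hxW
      have hadd : Wᶜ.indicator x + W.indicator x = x := Set.indicator_compl_add_self W x
      rw [← hadd] at hx hx' ⊢
      have hk : Wᶜ.indicator x ∉ edgePowerExponents G (k + 1) := fun h =>
        hx' (isUpperSet_edgePowerExponents _ le_self_add h)
      obtain ⟨j, hj, hmem⟩ := exists_level_of_notMem hk
      obtain ⟨a, b, hab, ha, hb⟩ := exists_mem_edgePowerExponents_of_add hdis hW h1 h2 hx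
      have := level_eq_of_mem hb hmem.2
      refine ⟨j, hj, Set.add_mem_add ⟨hmem, h2⟩
        ⟨⟨antitone_edgePowerExponents (by omega) ha, fun h => hx' ?_⟩, h1⟩⟩
      have := add_mem_edgePowerExponents hmem.1 h
      rwa [show j + (k - j + 1) = k + 1 by omega] at this
    · rintro ⟨j, hj, w, ⟨hw, hw'⟩, u, ⟨hu, hu'⟩, rfl⟩
      refine ⟨⟨?_, fun h => ?_⟩, add_mem_exponentsOn_union hu' hw'⟩
      · have := add_mem_edgePowerExponents hw.1 hu.1
        rwa [Nat.add_sub_cancel' (by omega)] at this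
      · obtain ⟨a, b, hab, ha, hb⟩ := exists_mem_edgePowerExponents_of_add hdis hW hu' hw' h
        have := level_eq_of_mem ha hu.2
        have := level_eq_of_mem hb hw.2
        omega
  rw [hU]
  refine HasConePartition.biUnion _ _ (fun j _ =>
    (hlevel j).add hdis.symm (hlevel' _) Set.inter_subset_right Set.inter_subset_right) ?_
  intro j hj l hl hjl
  exact disjoint_add_of_left hdis.symm Set.inter_subset_right Set.inter_subset_right
    Set.inter_subset_right Set.inter_subset_right
    ((pairwiseDisjoint_levels _ hj hl hjl).mono Set.inter_subset_left Set.inter_subset_left)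

lemma isTruncated_level_inter {j N : ℕ} (hN : 2 * (j + 1) ≤ N) (W : Set V) : IsTruncated N
    ((edgePowerExponents G j \ edgePowerExponents G (j + 1)) ∩ exponentsOn W) :=
  ((isTruncated_edgePowerExponents (by omega)).diff (isTruncated_edgePowerExponents hN)).inter
    (isTruncated_exponentsOn (by omega) W)

/-- A level is a difference of two upper sets, hence convex, and the direction escaping the next
power keeps a point in its level. -/
lemma hasConePartition_one_level [Finite V] {X : Set V} (hX : ∀ i j, G.Adj i j → (i ∈ X ↔ j ∉ X))
    {W : Set V} (hW : W.Nonempty) (j : ℕ) : HasConePartition 1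
      ((edgePowerExponents G j \ edgePowerExponents G (j + 1)) ∩ exponentsOn W) := by
  refine (isTruncated_level_inter le_rfl W).hasConePartition_one (by omega) ⟨?_⟩ ?_
  · rintro x ⟨⟨hx, -⟩, -⟩ z ⟨⟨-, hz⟩, hzW⟩ y ⟨hxy, hyz⟩
    exact ⟨⟨isUpperSet_edgePowerExponents _ hxy hx,
      fun h => hz (isUpperSet_edgePowerExponents _ hyz h)⟩, isLowerSet_exponentsOn W hyz hzW⟩
  · rintro u ⟨⟨hu, hu'⟩, huW⟩
    obtain ⟨v, hv, h⟩ := exists_ray_notMem_edgePowerExponents hX hW huW hu'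
    exact ⟨v, fun c => ⟨⟨isUpperSet_edgePowerExponents _ le_self_add hu, h c⟩,
      add_single_mem_exponentsOn huW hv c⟩⟩

lemma hasConePartition_one_upper [Finite V] {W : Set V} (hW : W.Nonempty) (k : ℕ) :
    HasConePartition 1 (edgePowerExponents G k ∩ exponentsOn W) := by
  refine ((isTruncated_edgePowerExponents (N := 2 * k + 1) (by omega)).inter
    (isTruncated_exponentsOn (by omega) W)).hasConePartition_one (by omega) ⟨?_⟩ ?_
  · rintro x ⟨hx, -⟩ z ⟨-, hzW⟩ y ⟨hxy, hyz⟩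
    exact ⟨isUpperSet_edgePowerExponents _ hxy hx, isLowerSet_exponentsOn W hyz hzW⟩
  · rintro u ⟨hu, huW⟩
    obtain ⟨v, hv⟩ := hW
    exact ⟨v, fun c => ⟨isUpperSet_edgePowerExponents _ le_self_add hu,
      add_single_mem_exponentsOn huW hv c⟩⟩

/-- Each fibre of `π` contributes one dimension. Levels and powers are treated together because the
splitting of powers uses the levels on the fibres already collected. -/
lemma hasConePartition_preimage [Finite V] {X : Set V}
    (hX : ∀ i j, G.Adj i j → (i ∈ X ↔ j ∉ X))
    {κ : Type*} {π : V → κ} (hπ : ∀ i j, G.Adj i j → π i = π j) (hsurj : π.Surjective)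
    (s : Finset κ) :
    (∀ j, HasConePartition s.card
      ((edgePowerExponents G j \ edgePowerExponents G (j + 1)) ∩ exponentsOn (π ⁻¹' s))) ∧
    ∀ k, HasConePartition s.card (edgePowerExponents G k ∩ exponentsOn (π ⁻¹' s)) := by
  classical
  induction s using Finset.induction_on with
  | empty =>
    exact ⟨fun j => (isTruncated_level_inter le_rfl _).hasConePartition_zero,
      fun k => ((isTruncated_edgePowerExponents (N := 2 * k + 1) (by omega)).inter
        (isTruncated_exponentsOn (by omega) _)).hasConePartition_zero⟩
  | insert a s ha ih =>
    have hdis : Disjoint (π ⁻¹' {a}) (π ⁻¹' (s : Set κ)) :=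
      Disjoint.preimage _ (by simpa using ha)
    have hW : ∀ i j, G.Adj i j → (i ∈ π ⁻¹' {a} ↔ j ∈ π ⁻¹' {a}) := fun i j hij => by
      simp [hπ i j hij]
    have hne : (π ⁻¹' {a}).Nonempty := hsurj a
    rw [Finset.card_insert_of_notMem ha, Finset.coe_insert, Set.insert_eq, Set.preimage_union]
    exact ⟨hasConePartition_level_union hdis hW ih.1 (hasConePartition_one_level hX hne),
      hasConePartition_union_of_levels hdis hW ih.1 ih.2 (hasConePartition_one_upper hne)⟩

theorem hasConePartition_edgePowerExponents [Finite V] (hbip : G.IsBipartite)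
    (hedge : G.edgeSet.Nonempty)
    (k : ℕ) : HasConePartition (Nat.card G.ConnectedComponent + 1) (edgePowerExponents G k) := by
  classical
  obtain ⟨col⟩ := hbip
  have hX : ∀ i j, G.Adj i j → (i ∈ {v | col v = 0} ↔ j ∉ {v | col v = 0}) := by
    intro i j hij
    have := col.valid hij
    simp only [Set.mem_ofPred_eq]
    omega
  let π : V → G.ConnectedComponent := G.connectedComponentMk
  have hπ : ∀ i j, G.Adj i j → π i = π j := fun i j hij =>
    SimpleGraph.ConnectedComponent.sound hij.reachable
  have hsurj : π.Surjective := SimpleGraph.ConnectedComponent.ind fun v => ⟨v, rfl⟩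
  have : Finite G.ConnectedComponent := Finite.of_surjective π hsurj
  have := Fintype.ofFinite G.ConnectedComponent
  obtain ⟨x, y, hxy⟩ : ∃ x y, G.Adj x y := by
    obtain ⟨e, he⟩ := hedge
    induction e with
    | h x y => exact ⟨x, y, he⟩
  have hnt : (π ⁻¹' {π x}).Nontrivial := ⟨x, rfl, y, (hπ x y hxy).symm, hxy.ne⟩
  -- The component of the edge `xy` is split off: it has two vertices and so contributes 2.
  let s : Finset G.ConnectedComponent := Finset.univ.erase (π x)
  have hs : Nat.card G.ConnectedComponent + 1 = s.card + 2 := by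
    have : s.card + 1 = _ := Finset.card_erase_add_one (Finset.mem_univ (π x))
    rw [Nat.card_eq_fintype_card, ← Finset.card_univ]
    omega
  have hdis : Disjoint (π ⁻¹' {π x}) (π ⁻¹' (s : Set _)) :=
    Disjoint.preimage _ (by simp [s])
  have hW : ∀ i j, G.Adj i j → (i ∈ π ⁻¹' {π x} ↔ j ∈ π ⁻¹' {π x}) := fun i j hij => by
    simp [hπ i j hij]
  have hall : π ⁻¹' {π x} ∪ π ⁻¹' (s : Set _) = Set.univ := by
    ext v
    simp only [s, Set.mem_union, Set.mem_preimage, Set.mem_singleton_iff, Finset.mem_coe,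
      Finset.mem_erase, Finset.mem_univ, and_true, Set.mem_univ, iff_true]
    tauto
  obtain ⟨h1, h2⟩ := hasConePartition_preimage hX hπ hsurj s
  have := hasConePartition_union_of_levels hdis hW h1 h2 (fun l =>
    IsUpperSet.hasConePartition_two (N := 2 * l + 1) (by omega)
      (isUpperSet_edgePowerExponents l) (isTruncated_edgePowerExponents (by omega)) hnt
      (fun u hu => exists_ray_notMem_edgePowerExponents hX hnt.nonempty hu)) k
  have huniv : exponentsOn (Set.univ : Set V) = Set.univ := by
    ext u
    simp [exponentsOn]
  rwa [hall, huniv, Set.inter_univ, ← hs] at this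

end Components

/-! ### From cone partitions to Stanley decompositions. -/

section StanleyDecompositions

open MvPolynomial

variable {V : Type*} {K : Type*} [Field K]

lemma stanleySpace_monomial_one (a : V →₀ ℕ) (Z : Finset V) :
    stanleySpace (monomial a (1 : K)) Z = restrictSupport K {u | ⇑u ∈ exponentCone a Z} := by
  rw [restrictSupport_eq_span, stanleySpace]
  congr 1
  ext f
  constructor
  · rintro ⟨b, hb, rfl⟩
    refine ⟨a + b, ⟨fun v => by simp, fun v hv => ?_⟩, by simp [monomial_mul]⟩
    have : b v = 0 := Finsupp.notMem_support_iff.1 fun h => hv (hb h)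
    simp [this]
  · rintro ⟨u, ⟨hau, hu⟩, rfl⟩
    have hle : a ≤ u := hau
    refine ⟨u - a, fun v hv => ?_, by simp [monomial_mul, add_tsub_cancel_of_le hle]⟩
    by_contra hvZ
    have := hu v hvZ
    rw [Finsupp.mem_support_iff, Finsupp.tsub_apply] at hv
    omega

lemma disjoint_restrictSupport_compl (s : Set (V →₀ ℕ)) :
    Disjoint (restrictSupport K s) (restrictSupport K sᶜ) := by
  rw [Submodule.disjoint_def]
  intro f hf hf'
  rw [mem_restrictSupport_iff] at hf hf'
  rw [← support_eq_empty, Finset.eq_empty_iff_forall_notMem]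
  exact fun u hu => hf' hu (hf hu)

lemma iSup_restrictSupport {ι : Sort*} (s : ι → Set (V →₀ ℕ)) :
    ⨆ t, restrictSupport K (s t) = restrictSupport K (⋃ t, s t) := by
  refine le_antisymm (iSup_le fun t => restrictSupport_mono K (Set.subset_iUnion s t)) ?_
  rw [restrictSupport_eq_span, Submodule.span_le]
  rintro _ ⟨u, hu, rfl⟩
  obtain ⟨t, ht⟩ := Set.mem_iUnion.1 hu
  exact Submodule.mem_iSup_of_mem t ((monomial_mem_restrictSupport K).2 (Or.inl ht))

/-- A cone partition of the exponents of the monomials in an ideal bounds its Stanley depth. -/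
theorem HasConePartition.le_stanleyDepth [Finite V] {d : ℕ} {A : Set (V → ℕ)}
    (hA : HasConePartition d A) {I : Ideal (MvPolynomial V K)}
    (hI : I.restrictScalars K = restrictSupport K {u | ⇑u ∈ A}) :
    (d : ℕ∞) ≤ stanleyDepth I := by
  obtain ⟨n, a, Z, hd, hdis, hU⟩ := hA.exists_family
  let b : Fin n → V →₀ ℕ := fun t => Finsupp.equivFunOnFinite.symm (a t)
  have hb : ∀ t, ⇑(b t) = a t := fun t => Finsupp.coe_equivFunOnFinite_symm (a t)
  have hspace : ∀ t, stanleySpace (monomial (b t) (1 : K)) (Z t) =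
      restrictSupport K {u | ⇑u ∈ exponentCone (a t) (Z t)} := fun t => by
    rw [stanleySpace_monomial_one, hb]
  let D : StanleyDecomposition I :=
    { size := n
      gen := fun t => monomial (b t) 1
      vars := Z
      gen_mem := fun t => by
        change _ ∈ I.restrictScalars K
        rw [hI, monomial_mem_restrictSupport]
        left
        rw [Set.mem_ofPred_eq, hb, ← hU]
        exact Set.mem_iUnion_of_mem t (self_mem_exponentCone _ _)
      gen_homogeneous := fun t => ⟨b t, 1, rfl⟩
      gen_ne_zero := fun t => by simp
      independent := by
        intro t
        simp only [hspace]
        -- All other Stanley spaces are supported off the cone of `t`, hence so is their sum.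
        refine (disjoint_restrictSupport_compl _).mono_right (iSup₂_le fun s hst => ?_)
        refine restrictSupport_mono K (Set.subset_compl_iff_disjoint_left.2 ?_)
        exact (hdis hst.symm).preimage _
      iSup_eq := by
        simp only [hspace]
        rw [iSup_restrictSupport, hI, ← hU]
        congr 1
        ext u
        simp }
  refine le_iSup_of_le D (le_iInf fun t => ?_)
  exact_mod_cast hd t

lemma edgeIdeal_pow_eq_span [Finite V] [DecidableEq V] (G : SimpleGraph V) (k : ℕ) :
    edgeIdeal K G ^ k =
      Ideal.span ((fun u => monomial u (1 : K)) '' {u | ⇑u ∈ edgePowerExponents G k}) := by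
  induction k with
  | zero =>
    rw [pow_zero, Ideal.one_eq_top, eq_comm, Ideal.eq_top_iff_one]
    exact Ideal.subset_span ⟨0, trivial, rfl⟩
  | succ k ih =>
    rw [pow_succ, ih, edgeIdeal, Ideal.span_mul_span']
    congr 1
    ext f
    constructor
    · rintro ⟨_, ⟨w, hw, rfl⟩, _, ⟨i, j, hij, rfl⟩, rfl⟩
      refine ⟨w + (Finsupp.single i 1 + Finsupp.single j 1), ⟨i, j, w, hij, hw, ?_⟩, ?_⟩
      · simp [Finsupp.single_eq_pi_single]
      · simp [X, monomial_mul]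
    · rintro ⟨u, ⟨i, j, w, hij, hw, hu⟩, rfl⟩
      refine ⟨_, ⟨Finsupp.equivFunOnFinite.symm w, by simpa using hw, rfl⟩, _,
        ⟨i, j, hij, rfl⟩, ?_⟩
      have : u = Finsupp.equivFunOnFinite.symm w +
          (Finsupp.single i 1 + Finsupp.single j 1) := by
        apply DFunLike.coe_injective
        simp [hu, Finsupp.single_eq_pi_single]
      simp [X, monomial_mul, this]

lemma edgeIdeal_pow_restrictScalars [Finite V] [DecidableEq V] (G : SimpleGraph V) (k : ℕ) :
    (edgeIdeal K G ^ k).restrictScalars K =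
      restrictSupport K {u | ⇑u ∈ edgePowerExponents G k} := by
  ext f
  rw [Submodule.restrictScalars_mem, edgeIdeal_pow_eq_span, mem_ideal_span_monomial_image,
    mem_restrictSupport_iff]
  refine forall₂_congr fun u _ => ⟨?_, fun hu => ⟨u, hu, le_rfl⟩⟩
  rintro ⟨w, hw, hwu⟩
  exact isUpperSet_edgePowerExponents k hwu hw

end StanleyDecompositions

theorem corollary3p5 (K : Type*) [Field K] {V : Type*} [Finite V] (G : SimpleGraph V)
    (hbip : G.IsBipartite) (hedge : G.edgeSet.Nonempty) (k : ℕ) (hk : 0 < k)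
    (hkg : 2 * (k : ℕ∞) ≤ maxComponentGirth G + 2) :
    (Nat.card G.ConnectedComponent : ℕ∞) + 1 ≤ stanleyDepth (edgeIdeal K G ^ k) := by
  classical
  exact_mod_cast (hasConePartition_edgePowerExponents hbip hedge k).le_stanleyDepth
    (edgeIdeal_pow_restrictScalars (K := K) G k)
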